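/- Let $\mathbf{k}$ be a field, $G$ a finite abelian group, $g_1,\dots,g_n\in G$, let $\chi_1,\dots,\chi_n\colon G\to\mathbf{k}^\times$ be characters, and put $q_{ij}=\chi_j(g_i)$. Let $V$ be the vector space with basis $x_1,\dots,x_n$, braiding $c(x_i\otimes x_j)=q_{ij}\,x_j\otimes x_i$, $G$-action $a\cdot x_i=\chi_i(a)x_i$ and $G$-coaction $x_i\mapsto g_i\otimes x_i$. Its Nichols algebra $\mathfrak{B}(V)$ is the quotient of the tensor algebra $T(V)$ (with the braided comultiplication for which the $x_i$ are primitive) by the largest two-sided ideal that is spanned by homogeneous elements of degree $\ge 2$, is stable under the action and the coaction of $G$, and is a coideal. Assume that $\mathfrak{B}(V)$ is finite-dimensional, and let $H=\mathfrak{B}(V)\#\mathbf{k}G$ be its bosonization, that is, $a x_i=\chi_i(a)x_i a$ and $\Delta(a)=a\otimes a$ for $a\in G$, and $\Delta(x_i)=g_i\otimes x_i+x_i\otimes 1$. Let $\varphi\in H^*$ be a nonzero right integral ($\varphi\psi=\psi(1)\varphi$ for all $\psi\in H^*$), and let $\rho$ be the Nakayama automorphism of $H$ with respect to $\varphi$,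 i.e. the algebra automorphism with $\varphi(yx)=\varphi(\rho(x)y)$ for all $x,y\in H$. Let $t\in H$ be a nonzero right integral ($th=\varepsilon(h)t$ for all $h\in H$), and let $\alpha\colon H\to\mathbf{k}$ be the modular function, i.e. the algebra map with $ht=\alpha(h)t$ for all $h\in H$. Put $$L_2=\alpha(G)\quad\text{and}\quad L_1=\langle q_{11},\dots,q_{nn},\alpha(G)\rangle\le\mathbf{k}^\times,\qquad H_\omega=\{h\in H:\rho(h)=\omega h\}\quad(\omega\in L_1).$$ Then $H=\bigoplus_{\omega\in L_1}H_\omega$, and the following are equivalent: 1. this decomposition is strongly graded, i.e. $H_\omega H_\tau=H_{\omega\tau}$ for all $\omega,\tau\in L_1$; 2. $L_1=L_2$; 3. each $H_\omega$, $\omega\in L_1$, contains an element of $G$; 4. $H$ is a crossed product $H_1\ltimes\mathbf{k}L_1$: there are a weak action of $L_1$ on $H_1$, a normalized two-cocycle $\sigma\colon L_1\times L_1\to H_1^\times$ for it, and an algebra isomorphism from $H_1\ltimes_\sigma\mathbf{k}L_1$ (with product $(a\ltimes\omega)(b\ltimes\tau)=a(\omega\cdot b)\sigma(\omega,\tau)\ltimes\omega\tau$)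 onto $H$ that is the identity on $H_1$ and maps $H_1\ltimes\omega$ into $H_\omega$ for every $\omega\in L_1$. -/

import Mathlib

open scoped TensorProduct

noncomputable section

namespace NicholsDiag

section Defs

variable {k : Type*} [Field k] {G : Type*} [CommGroup G] {n : ℕ}

/-- The action of `a : G` on the tensor algebra `T(V)` (the free algebra on the basis
`x₁, …, xₙ` of `V`) by algebra automorphisms: `a · xᵢ = χᵢ(a) xᵢ`. -/
def gAct (χ : Fin n → G →* kˣ) (a : G) : FreeAlgebra k (Fin n) →ₐ[k] FreeAlgebra k (Fin n) :=
  FreeAlgebra.lift k fun i => (χ i a : k) • FreeAlgebra.ι k i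

/-- The coaction of `kG` on `T(V)`, the algebra map with `xᵢ ↦ gᵢ ⊗ xᵢ`. -/
def gCoact (g : Fin n → G) :
    FreeAlgebra k (Fin n) →ₐ[k] MonoidAlgebra k G ⊗[k] FreeAlgebra k (Fin n) :=
  FreeAlgebra.lift k fun i => MonoidAlgebra.of k G (g i) ⊗ₜ[k] FreeAlgebra.ι k i

/-- Left multiplication by `xᵢ ⊗ 1 + 1 ⊗ xᵢ` in the braided tensor square of `T(V)`, where
`(1 ⊗ xᵢ) (a ⊗ b) = (gᵢ · a) ⊗ xᵢ b`, because the braiding moves `xᵢ` past `xⱼ` at the cost of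
the factor `qᵢⱼ = χⱼ(gᵢ)`. -/
def primMul (g : Fin n → G) (χ : Fin n → G →* kˣ) (i : Fin n) :
    Module.End k (FreeAlgebra k (Fin n) ⊗[k] FreeAlgebra k (Fin n)) :=
  TensorProduct.map (LinearMap.mulLeft k (FreeAlgebra.ι k i)) LinearMap.id +
    TensorProduct.map (gAct χ (g i)).toLinearMap (LinearMap.mulLeft k (FreeAlgebra.ι k i))

/-- The braided comultiplication of `T(V)`: the multiplicative map into the braided tensor square
for which all `xᵢ` are primitive, so `Δ(xᵢ f) = (xᵢ ⊗ 1 + 1 ⊗ xᵢ) Δ(f)` and `Δ(1) = 1 ⊗ 1`. -/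
def braidedComul (g : Fin n → G) (χ : Fin n → G →* kˣ) :
    FreeAlgebra k (Fin n) →ₗ[k] FreeAlgebra k (Fin n) ⊗[k] FreeAlgebra k (Fin n) :=
  (LinearMap.applyₗ (1 ⊗ₜ[k] 1)).comp (FreeAlgebra.lift k (primMul g χ)).toLinearMap

/-- The homogeneous component of degree `m` of `T(V)`. -/
def tDeg (k : Type*) [Field k] (n m : ℕ) : Submodule k (FreeAlgebra k (Fin n)) :=
  Submodule.span k (Set.range (FreeAlgebra.ι k)) ^ m

/-- The two-sided ideals of `T(V)` that are spanned by homogeneous elements of degree at least two,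
are Yetter-Drinfeld submodules, and are coideals for the braided comultiplication. -/
structure IsBraidedBiideal (g : Fin n → G) (χ : Fin n → G →* kˣ)
    (I : Ideal (FreeAlgebra k (Fin n))) : Prop where
  twoSided : I.IsTwoSided
  homogeneous : I.restrictScalars k ≤
    ⨆ m : {m : ℕ // 2 ≤ m}, I.restrictScalars k ⊓ tDeg k n m
  act_mem : ∀ a : G, ∀ f ∈ I, gAct χ a f ∈ I
  coact_mem : ∀ f ∈ I, gCoact (k := k) g f ∈
    LinearMap.range ((I.restrictScalars k).subtype.lTensor (MonoidAlgebra k G))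
  comul_mem : ∀ f ∈ I, braidedComul g χ f ∈
    LinearMap.range ((I.restrictScalars k).subtype.rTensor (FreeAlgebra k (Fin n))) ⊔
    LinearMap.range ((I.restrictScalars k).subtype.lTensor (FreeAlgebra k (Fin n)))

/-- The defining ideal of the Nichols algebra: the sum of all the ideals as above. -/
def nicholsIdeal (g : Fin n → G) (χ : Fin n → G →* kˣ) : Ideal (FreeAlgebra k (Fin n)) :=
  sSup {I | IsBraidedBiideal g χ I}

theorem nicholsIdeal_induction (g : Fin n → G) (χ : Fin n → G →* kˣ)
    {p : FreeAlgebra k (Fin n) → Prop}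
    (mem : ∀ I, IsBraidedBiideal g χ I → ∀ f ∈ I, p f) (zero : p 0)
    (add : ∀ f f', p f → p f' → p (f + f')) {f : FreeAlgebra k (Fin n)}
    (hf : f ∈ nicholsIdeal g χ) : p f := by
  unfold nicholsIdeal at hf
  rw [sSup_eq_iSup'] at hf
  exact Submodule.iSup_induction _ (motive := p) hf (fun I x hx => mem I.1 I.2 x hx) zero add

theorem le_nicholsIdeal {g : Fin n → G} {χ : Fin n → G →* kˣ} {I : Ideal (FreeAlgebra k (Fin n))}
    (hI : IsBraidedBiideal g χ I) : I ≤ nicholsIdeal g χ :=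
  le_sSup hI

instance (g : Fin n → G) (χ : Fin n → G →* kˣ) : (nicholsIdeal g χ).IsTwoSided where
  mul_mem_of_left b hf := by
    refine nicholsIdeal_induction g χ (p := fun f => f * b ∈ nicholsIdeal g χ) ?_ ?_ ?_ hf
    · intro I hI f hf
      have := hI.twoSided
      exact le_nicholsIdeal hI (I.mul_mem_right b hf)
    · simp
    · intro f f' h h'
      rw [add_mul]
      exact add_mem h h'

theorem gAct_mem (g : Fin n → G) (χ : Fin n → G →* kˣ) (a : G) {f : FreeAlgebra k (Fin n)}
    (hf : f ∈ nicholsIdeal g χ) : gAct χ a f ∈ nicholsIdeal g χ := by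
  refine nicholsIdeal_induction g χ (p := fun f => gAct χ a f ∈ nicholsIdeal g χ) ?_ ?_ ?_ hf
  · intro I hI f hf
    exact le_nicholsIdeal hI (hI.act_mem a f hf)
  · simp
  · intro f f' h h'
    rw [map_add]
    exact add_mem h h'

/-- The Nichols algebra `𝔅(V)` of the braided vector space `V` with basis `x₁, …, xₙ` and
braiding `c(xᵢ ⊗ xⱼ) = χⱼ(gᵢ) xⱼ ⊗ xᵢ`. -/
def Nichols (g : Fin n → G) (χ : Fin n → G →* kˣ) : Type _ :=
  FreeAlgebra k (Fin n) ⧸ nicholsIdeal g χ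

instance (g : Fin n → G) (χ : Fin n → G →* kˣ) : Ring (Nichols g χ) :=
  inferInstanceAs (Ring (FreeAlgebra k (Fin n) ⧸ nicholsIdeal g χ))

instance (g : Fin n → G) (χ : Fin n → G →* kˣ) : Algebra k (Nichols g χ) :=
  inferInstanceAs (Algebra k (FreeAlgebra k (Fin n) ⧸ nicholsIdeal g χ))

/-- The projection `T(V) → 𝔅(V)`. -/
def toNichols (g : Fin n → G) (χ : Fin n → G →* kˣ) : FreeAlgebra k (Fin n) →ₐ[k] Nichols g χ :=
  Ideal.Quotient.mkₐ k (nicholsIdeal g χ)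

theorem toNichols_surjective (g : Fin n → G) (χ : Fin n → G →* kˣ) :
    Function.Surjective (toNichols g χ) :=
  Ideal.Quotient.mk_surjective

theorem toNichols_eq_zero (g : Fin n → G) (χ : Fin n → G →* kˣ) {f : FreeAlgebra k (Fin n)}
    (hf : f ∈ nicholsIdeal g χ) : toNichols g χ f = 0 :=
  Ideal.Quotient.eq_zero_iff_mem.2 hf

/-- Algebra maps out of `𝔅(V)`. -/
def Nichols.lift (g : Fin n → G) (χ : Fin n → G →* kˣ) {B : Type*} [Semiring B] [Algebra k B]
    (f : FreeAlgebra k (Fin n) →ₐ[k] B) (hf : ∀ a ∈ nicholsIdeal g χ, f a = 0) :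
    Nichols g χ →ₐ[k] B :=
  Ideal.Quotient.liftₐ (nicholsIdeal g χ) f hf

@[simp]
theorem Nichols.lift_toNichols (g : Fin n → G) (χ : Fin n → G →* kˣ) {B : Type*} [Semiring B]
    [Algebra k B] (f : FreeAlgebra k (Fin n) →ₐ[k] B) (hf : ∀ a ∈ nicholsIdeal g χ, f a = 0)
    (a : FreeAlgebra k (Fin n)) : Nichols.lift g χ f hf (toNichols g χ a) = f a :=
  rfl

theorem Nichols.algHom_ext {g : Fin n → G} {χ : Fin n → G →* kˣ} {B : Type*} [Semiring B]
    [Algebra k B] {f f' : Nichols g χ →ₐ[k] B}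
    (h : ∀ i, f (toNichols g χ (FreeAlgebra.ι k i)) = f' (toNichols g χ (FreeAlgebra.ι k i))) :
    f = f' := by
  have : f.comp (toNichols g χ) = f'.comp (toNichols g χ) := by
    ext i
    exact h i
  ext a
  obtain ⟨a, rfl⟩ := toNichols_surjective g χ a
  exact congr($this a)

/-- The action of `a : G` on `𝔅(V)`. -/
def Nichols.act (g : Fin n → G) (χ : Fin n → G →* kˣ) (a : G) : Nichols g χ →ₐ[k] Nichols g χ :=
  Nichols.lift g χ ((toNichols g χ).comp (gAct χ a))
    fun _ hf => toNichols_eq_zero g χ (gAct_mem g χ a hf)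

theorem Nichols.act_x (g : Fin n → G) (χ : Fin n → G →* kˣ) (a : G) (i : Fin n) :
    Nichols.act g χ a (toNichols g χ (FreeAlgebra.ι k i)) =
      (χ i a : k) • toNichols g χ (FreeAlgebra.ι k i) := by
  simp [Nichols.act, gAct]

instance (g : Fin n → G) (χ : Fin n → G →* kˣ) : MulSemiringAction G (Nichols g χ) where
  smul a := Nichols.act g χ a
  one_smul b := by
    have : Nichols.act g χ 1 = AlgHom.id k _ := Nichols.algHom_ext fun i => by
      simp [Nichols.act_x]
    exact congr($this b)
  mul_smul a a' b := by
    have : Nichols.act g χ (a * a') = (Nichols.act g χ a).comp (Nichols.act g χ a') :=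
      Nichols.algHom_ext fun i => by
        simp [Nichols.act_x, smul_smul, mul_comm]
    exact congr($this b)
  smul_zero a := map_zero (Nichols.act g χ a)
  smul_add a := map_add (Nichols.act g χ a)
  smul_one a := map_one (Nichols.act g χ a)
  smul_mul a := map_mul (Nichols.act g χ a)

theorem Nichols.smul_def (g : Fin n → G) (χ : Fin n → G →* kˣ) (a : G) (b : Nichols g χ) :
    a • b = Nichols.act g χ a b :=
  rfl

instance (g : Fin n → G) (χ : Fin n → G →* kˣ) : SMulCommClass G k (Nichols g χ) where
  smul_comm a c b := map_smul (Nichols.act g χ a) c b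

/-- The bosonization `H = 𝔅(V) # kG`: the free `𝔅(V)`-module on `G` with the product
`(r # a) (s # b) = r (a · s) # a b`. -/
abbrev Bos (g : Fin n → G) (χ : Fin n → G →* kˣ) : Type _ :=
  SkewMonoidAlgebra (Nichols g χ) G

/-- The embedding `𝔅(V) → H`. -/
def ofNichols (g : Fin n → G) (χ : Fin n → G →* kˣ) : Nichols g χ →ₐ[k] Bos g χ where
  __ := SkewMonoidAlgebra.singleOneRingHom (k := Nichols g χ) (G := G)
  commutes' _ := rfl

/-- The embedding `G → H`. -/
def ofG (g : Fin n → G) (χ : Fin n → G →* kˣ) : G →* Bos g χ :=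
  SkewMonoidAlgebra.of (Nichols g χ) G

/-- The generators `xᵢ` of `H`. -/
def genX (g : Fin n → G) (χ : Fin n → G →* kˣ) (i : Fin n) : Bos g χ :=
  ofNichols g χ (toNichols g χ (FreeAlgebra.ι k i))

theorem ofG_mul_ofNichols (g : Fin n → G) (χ : Fin n → G →* kˣ) (a : G) (r : Nichols g χ) :
    ofG g χ a * ofNichols g χ r = ofNichols g χ (a • r) * ofG g χ a := by
  change SkewMonoidAlgebra.of (Nichols g χ) G a * SkewMonoidAlgebra.single 1 r =
    SkewMonoidAlgebra.single 1 (a • r) * SkewMonoidAlgebra.of (Nichols g χ) G a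
  simp

theorem single_eq (g : Fin n → G) (χ : Fin n → G →* kˣ) (a : G) (r : Nichols g χ) :
    SkewMonoidAlgebra.single a r = ofNichols g χ r * ofG g χ a := by
  change _ = SkewMonoidAlgebra.single 1 r * SkewMonoidAlgebra.of (Nichols g χ) G a
  simp

theorem ofG_mul_genX (g : Fin n → G) (χ : Fin n → G →* kˣ) (a : G) (i : Fin n) :
    ofG g χ a * genX g χ i = (χ i a : k) • (genX g χ i * ofG g χ a) := by
  rw [genX, ofG_mul_ofNichols, Nichols.smul_def, Nichols.act_x, map_smul, smul_mul_assoc]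

theorem Bos.algHom_ext {g : Fin n → G} {χ : Fin n → G →* kˣ} {B : Type*} [Semiring B]
    [Algebra k B] {f f' : Bos g χ →ₐ[k] B}
    (hG : ∀ a, f (ofG g χ a) = f' (ofG g χ a)) (hx : ∀ i, f (genX g χ i) = f' (genX g χ i)) :
    f = f' := by
  have h : f.comp (ofNichols g χ) = f'.comp (ofNichols g χ) := Nichols.algHom_ext hx
  apply AlgHom.toLinearMap_injective
  refine SkewMonoidAlgebra.lhom_ext fun a r => ?_
  rw [single_eq, AlgHom.toLinearMap_apply, AlgHom.toLinearMap_apply, map_mul, map_mul, hG]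
  exact congr($h r * _)

/-- Algebra maps out of `H`. -/
def Bos.lift (g : Fin n → G) (χ : Fin n → G →* kˣ) {B : Type*} [Semiring B] [Algebra k B]
    (f : Nichols g χ →ₐ[k] B) (u : G →* B)
    (h : ∀ a i, u a * f (toNichols g χ (FreeAlgebra.ι k i)) =
      (χ i a : k) • (f (toNichols g χ (FreeAlgebra.ι k i)) * u a)) : Bos g χ →ₐ[k] B :=
  SkewMonoidAlgebra.liftNCAlgHom f u (by
    intro r a
    obtain ⟨r, rfl⟩ := toNichols_surjective g χ r
    rw [Nichols.smul_def]
    induction r using FreeAlgebra.induction with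
    | grade0 c => simp [Algebra.commutes]
    | grade1 i => simp [Nichols.act_x, h]
    | mul r s hr hs =>
      rw [map_mul, map_mul, map_mul, map_mul, mul_assoc, hs, ← mul_assoc, hr, mul_assoc]
    | add r s hr hs =>
      rw [map_add, map_add, map_add, map_add, add_mul, mul_add, hr, hs])

theorem Bos.lift_ofNichols (g : Fin n → G) (χ : Fin n → G →* kˣ) {B : Type*} [Semiring B]
    [Algebra k B] (f : Nichols g χ →ₐ[k] B) (u : G →* B) (h) (r : Nichols g χ) :
    Bos.lift g χ f u h (ofNichols g χ r) = f r := by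
  change SkewMonoidAlgebra.liftNC (f : Nichols g χ →+ B) u (SkewMonoidAlgebra.single 1 r) = f r
  simp

theorem Bos.lift_ofG (g : Fin n → G) (χ : Fin n → G →* kˣ) {B : Type*} [Semiring B]
    [Algebra k B] (f : Nichols g χ →ₐ[k] B) (u : G →* B) (h) (a : G) :
    Bos.lift g χ f u h (ofG g χ a) = u a := by
  change SkewMonoidAlgebra.liftNC (f : Nichols g χ →+ B) u (SkewMonoidAlgebra.of _ G a) = u a
  simp

/-! The comultiplication of `H`. -/

/-- The algebra map `T(V) → H ⊗ H` with `xᵢ ↦ gᵢ ⊗ xᵢ + xᵢ ⊗ 1`. -/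
def comulT (g : Fin n → G) (χ : Fin n → G →* kˣ) :
    FreeAlgebra k (Fin n) →ₐ[k] Bos g χ ⊗[k] Bos g χ :=
  FreeAlgebra.lift k fun i => ofG g χ (g i) ⊗ₜ[k] genX g χ i + genX g χ i ⊗ₜ[k] 1

/-- The algebra map `T(V) → H ⊗ H` with `xᵢ ↦ gᵢ ⊗ xᵢ`. -/
def coactT (g : Fin n → G) (χ : Fin n → G →* kˣ) :
    FreeAlgebra k (Fin n) →ₐ[k] Bos g χ ⊗[k] Bos g χ :=
  FreeAlgebra.lift k fun i => ofG g χ (g i) ⊗ₜ[k] genX g χ i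

/-- The map `T(V) ⊗ T(V) → H ⊗ H` with `a ⊗ b ↦ a b₍₋₁₎ ⊗ b₍₀₎`. -/
def bosT (g : Fin n → G) (χ : Fin n → G →* kˣ) :
    FreeAlgebra k (Fin n) ⊗[k] FreeAlgebra k (Fin n) →ₗ[k] Bos g χ ⊗[k] Bos g χ :=
  (LinearMap.mul' k (Bos g χ ⊗[k] Bos g χ)).comp (TensorProduct.map
    ((Algebra.TensorProduct.includeLeft.comp (ofNichols g χ)).comp (toNichols g χ)).toLinearMap
    (coactT g χ).toLinearMap)

theorem bosT_tmul (g : Fin n → G) (χ : Fin n → G →* kˣ) (a b : FreeAlgebra k (Fin n)) :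
    bosT g χ (a ⊗ₜ b) = (ofNichols g χ (toNichols g χ a) ⊗ₜ 1) * coactT g χ b :=
  rfl

theorem bosT_primMul (g : Fin n → G) (χ : Fin n → G →* kˣ) (i : Fin n)
    (z : FreeAlgebra k (Fin n) ⊗[k] FreeAlgebra k (Fin n)) :
    bosT g χ (primMul g χ i z) =
      (ofG g χ (g i) ⊗ₜ[k] genX g χ i + genX g χ i ⊗ₜ[k] 1) * bosT g χ z := by
  induction z with
  | zero => simp
  | add y z hy hz => rw [map_add, map_add, map_add, hy, hz, mul_add]
  | tmul a b =>
    have h1 : coactT g χ (FreeAlgebra.ι k i * b) =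
        (ofG g χ (g i) ⊗ₜ[k] genX g χ i) * coactT g χ b := by
      simp [coactT]
    have h2 : ofNichols g χ (toNichols g χ (gAct χ (g i) a)) * ofG g χ (g i) =
        ofG g χ (g i) * ofNichols g χ (toNichols g χ a) := by
      rw [ofG_mul_ofNichols]
      rfl
    have h3 : primMul g χ i (a ⊗ₜ[k] b) = (FreeAlgebra.ι k i * a) ⊗ₜ[k] b +
        gAct χ (g i) a ⊗ₜ[k] (FreeAlgebra.ι k i * b) := rfl
    rw [h3, map_add, bosT_tmul, bosT_tmul, bosT_tmul, h1, map_mul, map_mul, ← mul_assoc,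
      Algebra.TensorProduct.tmul_mul_tmul, h2, one_mul, add_mul, add_comm, ← mul_assoc, ← mul_assoc,
      Algebra.TensorProduct.tmul_mul_tmul, Algebra.TensorProduct.tmul_mul_tmul, mul_one, mul_one]
    rfl

theorem comulT_eq (g : Fin n → G) (χ : Fin n → G →* kˣ) (f : FreeAlgebra k (Fin n)) :
    comulT g χ f = bosT g χ (braidedComul g χ f) := by
  have key : ∀ z, bosT g χ (FreeAlgebra.lift k (primMul g χ) f z) = comulT g χ f * bosT g χ z := by
    induction f using FreeAlgebra.induction with
    | grade0 c => intro z; simp [Algebra.algebraMap_eq_smul_one]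
    | grade1 i => intro z; simp [comulT, bosT_primMul]
    | mul r s hr hs =>
      intro z
      rw [map_mul, map_mul, Module.End.mul_apply, hr, hs, mul_assoc]
    | add r s hr hs =>
      intro z
      rw [map_add, map_add, LinearMap.add_apply, map_add, hr, hs, add_mul]
  have := key (1 ⊗ₜ 1)
  rw [bosT_tmul, map_one, map_one, map_one, mul_one] at this
  rw [← Algebra.TensorProduct.one_def (A := Bos g χ), mul_one] at this
  exact this.symm

theorem coactT_eq_zero (g : Fin n → G) (χ : Fin n → G →* kˣ) {I : Ideal (FreeAlgebra k (Fin n))}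
    (hI : IsBraidedBiideal g χ I) {f : FreeAlgebra k (Fin n)} (hf : f ∈ I) :
    coactT g χ f = 0 := by
  let u : MonoidAlgebra k G →ₐ[k] Bos g χ := MonoidAlgebra.lift k _ G (ofG g χ)
  let p : FreeAlgebra k (Fin n) →ₐ[k] Bos g χ := (ofNichols g χ).comp (toNichols g χ)
  have h : coactT g χ = (Algebra.TensorProduct.map u p).comp (gCoact g) := by
    ext i
    simp [coactT, gCoact, u, p, genX]
  obtain ⟨y, hy⟩ := hI.coact_mem f hf
  rw [h, AlgHom.comp_apply, ← hy]
  clear hy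
  induction y with
  | zero => simp
  | add y z hy hz => rw [map_add, map_add, hy, hz, add_zero]
  | tmul a b =>
    have : p b = 0 := by
      change ofNichols g χ (toNichols g χ b) = 0
      rw [toNichols_eq_zero g χ (le_nicholsIdeal hI b.2), map_zero]
    simp [this]

theorem comulT_eq_zero (g : Fin n → G) (χ : Fin n → G →* kˣ) (f : FreeAlgebra k (Fin n))
    (hf : f ∈ nicholsIdeal g χ) : comulT g χ f = 0 := by
  refine nicholsIdeal_induction g χ (p := fun f => comulT g χ f = 0) ?_ ?_ ?_ hf
  · intro I hI f hf
    rw [comulT_eq]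
    have hle : LinearMap.range ((I.restrictScalars k).subtype.rTensor (FreeAlgebra k (Fin n))) ⊔
        LinearMap.range ((I.restrictScalars k).subtype.lTensor (FreeAlgebra k (Fin n))) ≤
        LinearMap.ker (bosT g χ) := by
      refine sup_le ?_ ?_
      · rintro _ ⟨y, rfl⟩
        induction y with
        | zero => simp
        | add y z hy hz => rw [map_add]; exact add_mem hy hz
        | tmul a b =>
          rw [LinearMap.mem_ker, LinearMap.rTensor_tmul, bosT_tmul]
          rw [Submodule.subtype_apply, toNichols_eq_zero g χ (le_nicholsIdeal hI a.2)]
          simp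
      · rintro _ ⟨y, rfl⟩
        induction y with
        | zero => simp
        | add y z hy hz => rw [map_add]; exact add_mem hy hz
        | tmul a b =>
          rw [LinearMap.mem_ker, LinearMap.lTensor_tmul, bosT_tmul]
          rw [Submodule.subtype_apply, coactT_eq_zero g χ hI b.2, mul_zero]
    exact hle (hI.comul_mem f hf)
  · simp
  · intro f f' h h'
    rw [map_add, h, h', add_zero]

/-- The comultiplication of `H`: `Δ(a) = a ⊗ a` for `a ∈ G`, `Δ(xᵢ) = gᵢ ⊗ xᵢ + xᵢ ⊗ 1`. -/
def bosComul (g : Fin n → G) (χ : Fin n → G →* kˣ) : Bos g χ →ₐ[k] Bos g χ ⊗[k] Bos g χ :=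
  Bos.lift g χ (Nichols.lift g χ (comulT g χ) (comulT_eq_zero g χ))
    { toFun := fun a => ofG g χ a ⊗ₜ[k] ofG g χ a
      map_one' := by rw [map_one, Algebra.TensorProduct.one_def]
      map_mul' := fun a b => by rw [map_mul, Algebra.TensorProduct.tmul_mul_tmul] } (by
    intro a i
    have hc : ofG g χ a * ofG g χ (g i) = ofG g χ (g i) * ofG g χ a := by
      rw [← map_mul, ← map_mul, mul_comm]
    simp only [Nichols.lift_toNichols, comulT, FreeAlgebra.lift_ι_apply, MonoidHom.coe_mk,
      OneHom.coe_mk, mul_add, add_mul, Algebra.TensorProduct.tmul_mul_tmul, ofG_mul_genX, hc,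
      mul_one, one_mul, smul_add, TensorProduct.tmul_smul, TensorProduct.smul_tmul'])

theorem bosComul_ofG (g : Fin n → G) (χ : Fin n → G →* kˣ) (a : G) :
    bosComul g χ (ofG g χ a) = ofG g χ a ⊗ₜ[k] ofG g χ a := by
  rw [bosComul, Bos.lift_ofG]
  rfl

theorem bosComul_genX (g : Fin n → G) (χ : Fin n → G →* kˣ) (i : Fin n) :
    bosComul g χ (genX g χ i) = ofG g χ (g i) ⊗ₜ[k] genX g χ i + genX g χ i ⊗ₜ[k] 1 := by
  rw [bosComul, genX, Bos.lift_ofNichols]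
  simp [comulT, genX]

theorem counitT_eq_zero (g : Fin n → G) (χ : Fin n → G →* kˣ) (f : FreeAlgebra k (Fin n))
    (hf : f ∈ nicholsIdeal g χ) : FreeAlgebra.lift k (fun _ => (0 : k)) f = 0 := by
  refine nicholsIdeal_induction g χ
    (p := fun f => FreeAlgebra.lift k (fun _ => (0 : k)) f = 0) ?_ ?_ ?_ hf
  · intro I hI f hf
    have hle : (⨆ m : {m : ℕ // 2 ≤ m}, I.restrictScalars k ⊓ tDeg k n m) ≤
        LinearMap.ker (FreeAlgebra.lift k (fun _ : Fin n => (0 : k))).toLinearMap := by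
      refine iSup_le fun m => inf_le_right.trans ?_
      obtain ⟨m, hm⟩ := m
      obtain ⟨m, rfl⟩ : ∃ l, m = l + 1 := ⟨m - 1, by omega⟩
      rw [tDeg, pow_succ, Submodule.mul_le]
      intro a _ b hb
      have hb' : FreeAlgebra.lift k (fun _ : Fin n => (0 : k)) b = 0 := by
        induction hb using Submodule.span_induction with
        | mem x hx => obtain ⟨i, rfl⟩ := hx; simp
        | zero => simp
        | add x y _ _ hx hy => simp [hx, hy]
        | smul c x _ hx => simp [hx]
      simp [hb']
    exact hle (hI.homogeneous hf)
  · simp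
  · intro f f' h h'
    rw [map_add, h, h', add_zero]

/-- The counit of `H`: `ε(a) = 1` for `a ∈ G`, `ε(xᵢ) = 0`. -/
def bosCounit (g : Fin n → G) (χ : Fin n → G →* kˣ) : Bos g χ →ₐ[k] k :=
  Bos.lift g χ (Nichols.lift g χ (FreeAlgebra.lift k fun _ => 0) (counitT_eq_zero g χ)) 1
    (by intro a i; simp)

theorem bosCounit_ofG (g : Fin n → G) (χ : Fin n → G →* kˣ) (a : G) :
    bosCounit g χ (ofG g χ a) = 1 := by
  rw [bosCounit, Bos.lift_ofG]
  rfl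

theorem bosCounit_genX (g : Fin n → G) (χ : Fin n → G →* kˣ) (i : Fin n) :
    bosCounit g χ (genX g χ i) = 0 := by
  rw [bosCounit, genX, Bos.lift_ofNichols]
  simp

/-- The bialgebra structure of the bosonization `H = 𝔅(V) # kG`. -/
instance (g : Fin n → G) (χ : Fin n → G →* kˣ) : Bialgebra k (Bos g χ) :=
  Bialgebra.ofAlgHom (bosComul g χ) (bosCounit g χ)
    (Bos.algHom_ext (fun a => by simp [bosComul_ofG])
      (fun i => by
        simp [bosComul_genX, bosComul_ofG, TensorProduct.tmul_add, TensorProduct.add_tmul,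
          Algebra.TensorProduct.one_def, add_assoc]))
    (Bos.algHom_ext (fun a => by simp [bosComul_ofG, bosCounit_ofG])
      (fun i => by simp [bosComul_genX, bosCounit_ofG, bosCounit_genX]))
    (Bos.algHom_ext (fun a => by simp [bosComul_ofG, bosCounit_ofG])
      (fun i => by simp [bosComul_genX, bosCounit_genX]))

end Defs

section Frobenius

variable {k : Type*} [Field k] {A : Type*} [Ring A] [Bialgebra k A]

/-- `t` is a right integral of `A`: `t h = ε(h) t`. -/
def IsRightIntegral (t : A) : Prop :=
  ∀ h : A, t * h = Coalgebra.counit (R := k) h • t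

/-- `φ` is a right integral of the dual algebra `A*`: `φ ψ = ψ(1) φ` for all `ψ ∈ A*`, where the
product is `(φ ψ)(h) = φ(h₍₁₎) ψ(h₍₂₎)`. -/
def IsDualRightIntegral (φ : Module.Dual k A) : Prop :=
  ∀ (ψ : Module.Dual k A) (h : A),
    LinearMap.mul' k k (TensorProduct.map φ ψ (Coalgebra.comul h)) = ψ 1 * φ h

/-- `α` is the modular function of `A` determined by the right integral `t`: `a t = α(a) t`. -/
def IsModularFunction (t : A) (α : A →ₐ[k] k) : Prop :=
  ∀ a : A, a * t = α a • t

/-- `ρ` is the Nakayama automorphism for `φ`: `x φ = φ ρ(x)` in the bimodule `A*`, where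
`(x φ)(y) = φ(y x)` and `(φ x)(y) = φ(x y)`. -/
def IsNakayama (φ : Module.Dual k A) (ρ : A ≃ₐ[k] A) : Prop :=
  ∀ x y : A, φ (y * x) = φ (ρ x * y)

end Frobenius

section Graded

variable {k : Type*} [Field k] {A : Type*} [Ring A] [Algebra k A] {L : Type*} [Group L]

/-- `A` is the direct sum of the `𝒜 s`, and `𝒜 s 𝒜 t = 𝒜 (s t)` for all `s`, `t`. -/
def IsStronglyGraded [DecidableEq L] (𝒜 : L → Submodule k A) : Prop :=
  DirectSum.IsInternal 𝒜 ∧ ∀ s t : L, 𝒜 s * 𝒜 t = 𝒜 (s * t)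

/-- A (normalized) crossed system of the group `L` over the algebra `B`: a weak action of `L` on
`B` and a two-cocycle with invertible values. -/
structure CrossedSystem (k B L : Type*) [Field k] [Ring B] [Algebra k B] [Group L] where
  act : L → B →ₐ[k] B
  cocycle : L → L → Bˣ
  act_one : act 1 = AlgHom.id k B
  cocycle_one_left : ∀ s, cocycle 1 s = 1
  cocycle_one_right : ∀ s, cocycle s 1 = 1
  act_act : ∀ s t b, act s (act t b) * cocycle s t = cocycle s t * act (s * t) b
  cocycle_mul : ∀ r s t,
    act r (cocycle s t) * cocycle r (s * t) = (cocycle r s * cocycle (r * s) t : B)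

/-- The product of the crossed product `B ⋉ kL`, whose underlying space is the free left
`B`-module on `L`: `(a ⋉ s) (b ⋉ t) = a (s · b) σ(s, t) ⋉ s t`. -/
def CrossedSystem.mul {B : Type*} [Ring B] [Algebra k B] (S : CrossedSystem k B L)
    (u v : L →₀ B) : L →₀ B :=
  u.sum fun s a => v.sum fun t b => Finsupp.single (s * t) (a * S.act s b * S.cocycle s t)

/-- The algebra `A` with components `𝒜 s` and neutral component `B = 𝒜 1` is a crossed product
`B ⋉ kL`: it is isomorphic to such an algebra, by an isomorphism that is the identity on `B` and
respects the `L`-degrees. -/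
def IsCrossedProduct (B : Subalgebra k A) (𝒜 : L → Submodule k A) : Prop :=
  ∃ (S : CrossedSystem k B L) (e : (L →₀ B) ≃ₗ[k] A),
    (∀ b : B, e (Finsupp.single 1 b) = b) ∧
    (∀ (s : L) (b : B), e (Finsupp.single s b) ∈ 𝒜 s) ∧
    ∀ u v : L →₀ B, e (S.mul u v) = e u * e v

/-- The eigenspace `{h | ρ(h) = ω h}`. -/
def eigen (ρ : A ≃ₐ[k] A) (ω : kˣ) : Submodule k A :=
  Module.End.eigenspace ρ.toLinearMap (ω : k)

/-- The subalgebra `{h | ρ(h) = h}`. -/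
def fixed (ρ : A ≃ₐ[k] A) : Subalgebra k A :=
  AlgHom.equalizer (ρ : A →ₐ[k] A) (AlgHom.id k A)

end Graded

section Groups

variable {k : Type*} [Field k] {G : Type*} [CommGroup G] {n : ℕ}
  {g : Fin n → G} {χ : Fin n → G →* kˣ}

/-- The subgroup `L₂ = α(G)` of `kˣ`. -/
def L₂ (α : Bos g χ →ₐ[k] k) : Subgroup kˣ :=
  ((α : Bos g χ →* k).comp (ofG g χ)).toHomUnits.range

/-- The subgroup `L₁` of `kˣ` generated by the `qᵢᵢ = χᵢ(gᵢ)` and `α(G)`. -/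
def L₁ (α : Bos g χ →ₐ[k] k) : Subgroup kˣ :=
  Subgroup.closure (Set.range (fun i => χ i (g i)) ∪ L₂ α)

end Groups

end NicholsDiag

end

/-!
For a right integral `φ` of the dual of a Hopf algebra one has
`φ(x₍₁₎ y) x₍₂₎ = S(φ(x y₍₁₎) y₍₂₎)`. If `φ ≠ 0`, this makes the form `(x, y) ↦ φ(x y)`
nondegenerate, and it gives `Δ ∘ ρ = (ρ ⊗ S²) ∘ Δ`, whence `ρ(x) = ε(ρ(x₍₁₎)) S²(x₍₂₎)`. So `ρ` is
determined by the character `ε ∘ ρ`. This character vanishes on the nilpotent elements `xᵢ`, and it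
is `α⁻¹` on `G` because `α ∘ ρ = ε`: indeed `α(ρ(x)) φ(t) = φ(ρ(x) t) = φ(t x) = ε(x) φ(t)`, and
`φ(t) ≠ 0`. Therefore `ρ` multiplies `a ∈ G` by `α(a)⁻¹` and `xᵢ` by `α(gᵢ)⁻¹ qᵢᵢ⁻¹`.

The projection `H → kG` carries `ρ` to the map `a ↦ α(a)⁻¹ a`, so it kills `H_ω` for `ω ∉ L₂`.
As it is multiplicative and `1` does not lie in its kernel, `1 ∈ H_ω H_{ω⁻¹}` forces `ω ∈ L₂`.
Conversely, the elements of `G` are homogeneous units of `H`, and a grading with units in all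
degrees is a crossed product.

The antipode comes from the Galois map `x ⊗ y ↦ Δ(x) (1 ⊗ y)`: it is surjective since its range
contains `x ⊗ 1` for each generator `x`.
-/

noncomputable section

namespace NicholsDiag

section Contraction

variable {R M N P Q : Type*} [CommSemiring R] [AddCommMonoid M] [Module R M] [AddCommMonoid N]
  [Module R N] [AddCommMonoid P] [Module R P] [AddCommMonoid Q] [Module R Q]

/-- The contraction `m ⊗ n ↦ ψ(m) n` of the left tensor factor by a functional `ψ`. -/
def contract (ψ : Module.Dual R M) : M ⊗[R] N →ₗ[R] N :=
  TensorProduct.lid R N ∘ₗ ψ.rTensor N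

@[simp]
theorem contract_tmul (ψ : Module.Dual R M) (m : M) (y : N) : contract ψ (m ⊗ₜ y) = ψ m • y :=
  rfl

theorem contract_map (ψ : Module.Dual R P) (f : M →ₗ[R] P) (f' : N →ₗ[R] Q) (z : M ⊗[R] N) :
    contract ψ (TensorProduct.map f f' z) = f' (contract (ψ ∘ₗ f) z) := by
  have h : contract ψ ∘ₗ TensorProduct.map f f' = f' ∘ₗ contract (ψ ∘ₗ f) := by
    ext
    simp
  exact congr($h z)

theorem contract_mul_tmul {A B : Type*} [Semiring A] [Algebra R A] [Semiring B] [Algebra R B]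
    (ψ : Module.Dual R A) (z : A ⊗[R] B) (x : A) (y : B) :
    contract ψ (z * (x ⊗ₜ y)) = contract (ψ ∘ₗ LinearMap.mulRight R x) z * y := by
  have h : contract ψ ∘ₗ LinearMap.mulRight R (x ⊗ₜ y) =
      LinearMap.mulRight R y ∘ₗ contract (ψ ∘ₗ LinearMap.mulRight R x) := by
    ext
    simp
  exact congr($h z)

theorem contract_counit_comul {C : Type*} [AddCommMonoid C] [Module R C] [Coalgebra R C] (c : C) :
    contract (Coalgebra.counit (R := R)) (Coalgebra.comul (R := R) c) = c := by
  simp [contract]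

/-- The bilinear form `(x, y) ↦ φ(x y)` on an algebra. -/
def frobeniusForm {A : Type*} [Semiring A] [Algebra R A] (φ : Module.Dual R A) :
    LinearMap.BilinForm R A :=
  (LinearMap.mul R A).compr₂ φ

@[simp]
theorem frobeniusForm_apply {A : Type*} [Semiring A] [Algebra R A] (φ : Module.Dual R A)
    (x y : A) : frobeniusForm φ x y = φ (x * y) :=
  rfl

end Contraction

section Pairing

variable {R M M' N : Type*} [CommRing R] [AddCommGroup M] [Module R M] [AddCommGroup M']
  [Module R M'] [AddCommGroup N] [Module R N] [Module.Free R N]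

theorem mem_range_rTensor_ker {B : M →ₗ[R] M' →ₗ[R] R} {z : M ⊗[R] N}
    (hz : ∀ y, contract (B.flip y) z = 0) :
    z ∈ LinearMap.range ((LinearMap.ker B).subtype.rTensor N) := by
  let b := Module.Free.chooseBasis R N
  obtain ⟨c, rfl⟩ := TensorProduct.eq_repr_basis_right b z
  have hc (i) : c i ∈ LinearMap.ker B := by
    ext y
    classical
    by_cases hi : c i = 0
    · simp [hi]
    · simpa [Finsupp.sum, Finsupp.single_apply, hi] using congr(b.repr $(hz y) i)
  exact sum_mem fun i _ => ⟨⟨c i, hc i⟩ ⊗ₜ b i, rfl⟩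

theorem eq_of_forall_contract_eq {B : M →ₗ[R] M' →ₗ[R] R} (hB : LinearMap.ker B = ⊥)
    {z w : M ⊗[R] N} (h : ∀ y, contract (B.flip y) z = contract (B.flip y) w) : z = w := by
  obtain ⟨v, hv⟩ := mem_range_rTensor_ker (B := B) (z := z - w) fun y => by
    rw [map_sub, h, sub_self]
  have hsub : (LinearMap.ker B).subtype = 0 := by
    ext v
    exact (Submodule.mem_bot R).1 (hB ▸ v.2)
  rw [hsub, LinearMap.rTensor_zero, LinearMap.zero_apply] at hv
  exact sub_eq_zero.1 hv.symm

end Pairing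

section DualIntegral

open Coalgebra LinearMap HopfAlgebra WithConv

theorem antipode_antipode_of_comul_eq {R A : Type*} [CommRing R] [Ring A] [HopfAlgebra R A]
    {a x : A} (ha : IsGroupLikeElem R a)
    (hx : comul (R := R) x = a ⊗ₜ x + x ⊗ₜ 1) :
    antipode R (antipode R x) = antipode R a * x * a := by
  have hcounit : counit (R := R) x = 0 := by
    have h := congr(counit (R := R) $(contract_counit_comul (R := R) x))
    simpa [hx, ha.counit_eq_one] using h
  have hS : antipode R x = -(antipode R a * x) := by
    have h := mul_antipode_rTensor_comul_apply (R := R) x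
    rw [hx, hcounit, map_zero] at h
    simpa [add_comm, add_eq_zero_iff_eq_neg] using h
  rw [hS, map_neg, antipode_mul_antidistrib, ha.antipode_antipode, hS, neg_mul, neg_neg]

variable {k : Type*} [Field k] {A : Type*} [Ring A]

theorem IsDualRightIntegral.contract_comul [Bialgebra k A] {φ : Module.Dual k A}
    (hφ : IsDualRightIntegral φ) (h : A) : contract φ (comul (R := k) h) = φ h • (1 : A) := by
  have hψ (ψ : Module.Dual k A) (z : A ⊗[k] A) :
      ψ (contract φ z) = mul' k k (TensorProduct.map φ ψ z) := by
    have : ψ ∘ₗ contract φ = mul' k k ∘ₗ TensorProduct.map φ ψ := by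
      ext
      simp
    exact congr($this z)
  rw [← sub_eq_zero, ← Module.forall_dual_apply_eq_zero_iff k]
  intro ψ
  rw [map_sub, hψ, hφ, map_smul, smul_eq_mul, mul_comm, sub_self]

variable [HopfAlgebra k A] {φ : Module.Dual k A}

/- In the convolution algebra of endomorphisms of `A`, the maps `P y = φ(x₍₁₎ y) x₍₂₎` and
`Q y = φ(x y) 1` satisfy `P * id = Q`, hence `P = Q * S`. -/
theorem IsDualRightIntegral.contract_comul_mulRight (hφ : IsDualRightIntegral φ) (x y : A) :
    contract (φ ∘ₗ mulRight k y) (comul (R := k) x) =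
      antipode k (contract (φ ∘ₗ mulLeft k x) (comul (R := k) y)) := by
  let P : WithConv (A →ₗ[k] A) := toConv <|
    contract φ ∘ₗ mulLeft k (comul (R := k) x) ∘ₗ (TensorProduct.mk k A A).flip 1
  let Q : WithConv (A →ₗ[k] A) := toConv ((φ ∘ₗ mulLeft k x).smulRight 1)
  have hPid : P * toConv .id = Q := by
    have h : mul' k A ∘ₗ TensorProduct.map P.ofConv .id =
        contract φ ∘ₗ mulLeft k (comul (R := k) x) := by
      ext u v
      simp [P, contract_mul_tmul]
    ext z
    change (mul' k A ∘ₗ TensorProduct.map P.ofConv .id) (comul z) = φ (x * z) • (1 : A)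
    rw [h, comp_apply, mulLeft_apply, ← Bialgebra.comul_mul, hφ.contract_comul]
  have hP : P = Q * toConv (antipode k) := by
    rw [← hPid, mul_assoc, id_mul_antipode, mul_one]
  have hQ : mul' k A ∘ₗ TensorProduct.map Q.ofConv (antipode k) =
      antipode k ∘ₗ contract (φ ∘ₗ mulLeft k x) := by
    ext u v
    simp [Q]
  calc contract (φ ∘ₗ mulRight k y) (comul (R := k) x) = P.ofConv y := by
        simp [P, contract_mul_tmul]
    _ = (mul' k A ∘ₗ TensorProduct.map Q.ofConv (antipode k)) (comul y) := congr($hP y)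
    _ = antipode k (contract (φ ∘ₗ mulLeft k x) (comul (R := k) y)) := congr($hQ _)

theorem IsDualRightIntegral.ker_frobeniusForm (hφ : IsDualRightIntegral φ) (hφ0 : φ ≠ 0) :
    LinearMap.ker (frobeniusForm φ) = ⊥ := by
  have comul_mem {z : A} (hz : z ∈ LinearMap.ker (frobeniusForm φ)) :
      comul z ∈ LinearMap.range ((LinearMap.ker (frobeniusForm φ)).subtype.rTensor A) := by
    refine mem_range_rTensor_ker fun y => ?_
    change contract (φ ∘ₗ mulRight k y) _ = 0
    have hz' : φ ∘ₗ mulLeft k z = 0 := hz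
    rw [hφ.contract_comul_mulRight, hz']
    simp [contract]
  have counit_eq_zero {z : A} (hz : z ∈ LinearMap.ker (frobeniusForm φ)) :
      counit (R := k) z = 0 := by
    obtain ⟨w, hw⟩ := comul_mem hz
    have hmem : algebraMap k A (counit z) ∈ LinearMap.ker (frobeniusForm φ) := by
      rw [← mul_antipode_lTensor_comul_apply, ← hw]
      clear hw
      induction w with
      | zero => simp
      | add u v hu hv => simp only [map_add]; exact add_mem hu hv
      | tmul u v =>
        ext y
        change φ (u * antipode k v * y) = 0
        rw [mul_assoc]
        exact congr($(u.2) (antipode k v * y))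
    by_contra h
    refine hφ0 (LinearMap.ext fun y => ?_)
    simpa [Algebra.algebraMap_eq_smul_one, h] using congr($hmem y)
  refine (Submodule.eq_bot_iff _).2 fun z hz => ?_
  obtain ⟨w, hw⟩ := comul_mem hz
  have hsub : counit ∘ₗ (LinearMap.ker (frobeniusForm φ)).subtype = 0 :=
    LinearMap.ext fun u => counit_eq_zero u.2
  rw [← contract_counit_comul (R := k) z, ← hw, rTensor, contract_map, hsub]
  simp [contract]

theorem IsDualRightIntegral.comul_nakayama (hφ : IsDualRightIntegral φ) (hφ0 : φ ≠ 0)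
    {ρ : A ≃ₐ[k] A} (hρ : IsNakayama φ ρ) (x : A) :
    comul (R := k) (ρ x) =
      TensorProduct.map ρ.toLinearMap (antipode k ∘ₗ antipode k) (comul (R := k) x) := by
  have hρ' (y : A) : φ ∘ₗ mulLeft k (ρ y) = φ ∘ₗ mulRight k y := by
    ext z
    exact (hρ y z).symm
  have hρ'' (y : A) : φ ∘ₗ mulLeft k y = (φ ∘ₗ mulRight k y) ∘ₗ ρ.toLinearMap := by
    ext z
    exact hρ z y
  refine eq_of_forall_contract_eq (hφ.ker_frobeniusForm hφ0) fun y => ?_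
  change contract (φ ∘ₗ mulRight k y) _ = contract (φ ∘ₗ mulRight k y) _
  rw [hφ.contract_comul_mulRight, hρ', hφ.contract_comul_mulRight, hρ'', contract_map]
  rfl

theorem IsDualRightIntegral.nakayama_eq (hφ : IsDualRightIntegral φ) (hφ0 : φ ≠ 0)
    {ρ : A ≃ₐ[k] A} (hρ : IsNakayama φ ρ) (x : A) :
    ρ x = antipode k (antipode k
      (contract (counit (R := k) ∘ₗ ρ.toLinearMap) (comul (R := k) x))) := by
  rw [← contract_counit_comul (R := k) (ρ x), hφ.comul_nakayama hφ0 hρ, contract_map]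
  rfl

theorem IsDualRightIntegral.nakayama_of_isGroupLikeElem (hφ : IsDualRightIntegral φ) (hφ0 : φ ≠ 0)
    {ρ : A ≃ₐ[k] A} (hρ : IsNakayama φ ρ) {a : A} (ha : IsGroupLikeElem k a) :
    ρ a = counit (R := k) (ρ a) • a := by
  conv_lhs => rw [hφ.nakayama_eq hφ0 hρ, ha.comul_eq_tmul_self, contract_tmul, map_smul, map_smul,
    ha.antipode_antipode]
  rfl

theorem IsDualRightIntegral.nakayama_of_comul_eq (hφ : IsDualRightIntegral φ) (hφ0 : φ ≠ 0)
    {ρ : A ≃ₐ[k] A} (hρ : IsNakayama φ ρ) {a x : A} (ha : IsGroupLikeElem k a)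
    (hx : comul (R := k) x = a ⊗ₜ x + x ⊗ₜ 1) :
    ρ x = counit (R := k) (ρ a) • (antipode k a * x * a) + counit (R := k) (ρ x) • (1 : A) := by
  conv_lhs => rw [hφ.nakayama_eq hφ0 hρ, hx, map_add, contract_tmul, contract_tmul, map_add,
    map_add, map_smul, map_smul, map_smul, map_smul, antipode_antipode_of_comul_eq ha hx,
    antipode_one, antipode_one]
  rfl

theorem IsRightIntegral.apply_ne_zero {t : A} (ht : IsRightIntegral (k := k) t) (ht0 : t ≠ 0)
    (hφ : IsDualRightIntegral φ) (hφ0 : φ ≠ 0) : φ t ≠ 0 := by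
  intro h
  have hker : t ∈ LinearMap.ker (frobeniusForm φ) := by
    ext y
    simp [ht y, h]
  rw [hφ.ker_frobeniusForm hφ0] at hker
  exact ht0 hker

theorem IsModularFunction.apply_nakayama {t : A} {α : A →ₐ[k] k} (hα : IsModularFunction t α)
    (ht : IsRightIntegral (k := k) t) (ht0 : t ≠ 0) (hφ : IsDualRightIntegral φ) (hφ0 : φ ≠ 0)
    {ρ : A ≃ₐ[k] A} (hρ : IsNakayama φ ρ) (x : A) : α (ρ x) = counit (R := k) x := by
  refine mul_right_cancel₀ (ht.apply_ne_zero ht0 hφ hφ0) ?_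
  calc α (ρ x) * φ t = φ (ρ x * t) := by rw [hα, map_smul, smul_eq_mul]
    _ = φ (t * x) := (hρ x t).symm
    _ = counit (R := k) x * φ t := by rw [ht, map_smul, smul_eq_mul]

end DualIntegral

section GaloisMap

open Coalgebra LinearMap WithConv Algebra.TensorProduct

section

variable (R A : Type*) [CommSemiring R] [Semiring A] [Bialgebra R A]

/-- The Galois map `x ⊗ y ↦ Δ(x) (1 ⊗ y)`, which is bijective if and only if the identity of `A`
is convolution invertible. -/
def galoisMap : A ⊗[R] A →ₗ[R] A ⊗[R] A :=
  TensorProduct.lift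
    ((LinearMap.mul R (A ⊗[R] A)).compl₁₂ (comul (R := R)) (TensorProduct.mk R A A 1))

variable {R A}

@[simp]
theorem galoisMap_tmul (x y : A) : galoisMap R A (x ⊗ₜ y) = comul (R := R) x * (1 ⊗ₜ y) :=
  rfl

theorem galoisMap_mul_one_tmul (w : A ⊗[R] A) (y : A) :
    galoisMap R A (w * (1 ⊗ₜ y)) = galoisMap R A w * (1 ⊗ₜ y) := by
  have h : galoisMap R A ∘ₗ mulRight R (1 ⊗ₜ y) = mulRight R (1 ⊗ₜ y) ∘ₗ galoisMap R A := by
    ext u v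
    simp [mul_assoc]
  exact congr($h w)

theorem galoisMap_tmul_one_mul (x : A) (w : A ⊗[R] A) :
    galoisMap R A ((x ⊗ₜ 1) * w) = comul (R := R) x * galoisMap R A w := by
  have h : galoisMap R A ∘ₗ mulLeft R (x ⊗ₜ 1) = mulLeft R (comul (R := R) x) ∘ₗ galoisMap R A := by
    ext u v
    simp [mul_assoc]
  exact congr($h w)

theorem mul_tmul_one_mem_range_galoisMap {x y : A} (hx : x ⊗ₜ 1 ∈ range (galoisMap R A))
    (hy : y ⊗ₜ 1 ∈ range (galoisMap R A)) : (x * y) ⊗ₜ 1 ∈ range (galoisMap R A) := by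
  obtain ⟨z, hz⟩ := hy
  have galoisMap_mul_mem (w : A ⊗[R] A) :
      galoisMap R A w * (y ⊗ₜ 1) ∈ range (galoisMap R A) := by
    induction w with
    | zero => simp
    | add v w hv hw => rw [map_add, add_mul]; exact add_mem hv hw
    | tmul u v =>
      refine ⟨(u ⊗ₜ 1) * z * (1 ⊗ₜ v), ?_⟩
      rw [galoisMap_mul_one_tmul, galoisMap_tmul_one_mul, hz]
      simp [mul_assoc]
  obtain ⟨w, hw⟩ := hx
  simpa [hw] using galoisMap_mul_mem w

theorem galoisMap_surjective_of_adjoin_eq_top {s : Set A} (hs : Algebra.adjoin R s = ⊤)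
    (h : ∀ x ∈ s, x ⊗ₜ 1 ∈ range (galoisMap R A)) : Function.Surjective (galoisMap R A) := by
  have tmul_one_mem (x : A) : x ⊗ₜ 1 ∈ range (galoisMap R A) := by
    induction (hs ▸ Algebra.mem_top : x ∈ Algebra.adjoin R s) using Algebra.adjoin_induction with
    | mem x hx => exact h x hx
    | algebraMap r => exact ⟨algebraMap R A r ⊗ₜ 1, by simp⟩
    | add x y _ _ hx hy => rw [TensorProduct.add_tmul]; exact add_mem hx hy
    | mul x y _ _ hx hy => exact mul_tmul_one_mem_range_galoisMap hx hy
  rw [← range_eq_top, ← top_le_iff, ← TensorProduct.span_tmul_eq_top, Submodule.span_le]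
  rintro _ ⟨x, y, rfl⟩
  obtain ⟨w, hw⟩ := tmul_one_mem x
  exact ⟨w * (1 ⊗ₜ y), by rw [galoisMap_mul_one_tmul, hw]; simp⟩

theorem mul'_map_galoisMap (f : WithConv (A →ₗ[R] A)) (w : A ⊗[R] A) :
    mul' R A (TensorProduct.map f.ofConv LinearMap.id (galoisMap R A w)) =
      mul' R A (TensorProduct.map (f * toConv LinearMap.id).ofConv LinearMap.id w) := by
  have mul_one_tmul (v : A ⊗[R] A) (y : A) :
      mul' R A (TensorProduct.map f.ofConv LinearMap.id (v * (1 ⊗ₜ y))) =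
        mul' R A (TensorProduct.map f.ofConv LinearMap.id v) * y := by
    have h : mul' R A ∘ₗ TensorProduct.map f.ofConv LinearMap.id ∘ₗ mulRight R (1 ⊗ₜ y) =
        mulRight R y ∘ₗ mul' R A ∘ₗ TensorProduct.map f.ofConv LinearMap.id := by
      ext a b
      simp [mul_assoc]
    exact congr($h v)
  have h : mul' R A ∘ₗ TensorProduct.map f.ofConv LinearMap.id ∘ₗ galoisMap R A =
      mul' R A ∘ₗ TensorProduct.map (f * toConv LinearMap.id).ofConv LinearMap.id := by
    ext x y
    exact mul_one_tmul (comul x) y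
  exact congr($h w)

theorem convMul_id_injective_of_galoisMap_surjective (h : Function.Surjective (galoisMap R A)) :
    Function.Injective fun f : WithConv (A →ₗ[R] A) => f * toConv LinearMap.id := by
  intro f f' (hff' : f * toConv LinearMap.id = f' * toConv LinearMap.id)
  ext x
  obtain ⟨w, hw⟩ := h (x ⊗ₜ 1)
  have hx := mul'_map_galoisMap f w
  rw [hff', ← mul'_map_galoisMap f' w, hw] at hx
  simpa using hx

end

variable {k A : Type*} [Field k] [Ring A] [Bialgebra k A] [Module.Finite k A]

theorem exists_conv_inverse_id_of_galoisMap_surjective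
    (h : Function.Surjective (galoisMap k A)) :
    ∃ S : WithConv (A →ₗ[k] A), S * toConv LinearMap.id = 1 ∧ toConv LinearMap.id * S = 1 := by
  have hinj := convMul_id_injective_of_galoisMap_surjective h
  have := Module.Finite.equiv (WithConv.linearEquiv k (A →ₗ[k] A)).symm
  obtain ⟨S, hS⟩ :=
    injective_iff_surjective (f := mulRight k (toConv (LinearMap.id : A →ₗ[k] A))).1 hinj 1
  rw [mulRight_apply] at hS
  refine ⟨S, hS, hinj ?_⟩
  change toConv LinearMap.id * S * toConv LinearMap.id = 1 * toConv LinearMap.id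
  rw [mul_assoc, hS, mul_one, one_mul]

/-- A finite-dimensional bialgebra with surjective Galois map is a Hopf algebra: the antipode is
the convolution inverse of the identity. -/
@[reducible]
def hopfAlgebraOfGaloisMapSurjective (h : Function.Surjective (galoisMap k A)) :
    HopfAlgebra k A where
  antipode := (exists_conv_inverse_id_of_galoisMap_surjective h).choose.ofConv
  mul_antipode_rTensor_comul :=
    congrArg ofConv (exists_conv_inverse_id_of_galoisMap_surjective h).choose_spec.1
  mul_antipode_lTensor_comul :=
    congrArg ofConv (exists_conv_inverse_id_of_galoisMap_surjective h).choose_spec.2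

end GaloisMap

section Grading

variable {k A L : Type*} [CommRing k] [Ring A] [Algebra k A] [Group L] {B : Subalgebra k A}
  {𝒜 : L → Submodule k A}

/-- The family `𝒜` is a grading of the algebra `A` by the group `L` with neutral component `B`.
Mathlib's `GradedAlgebra` requires an additive index monoid. -/
structure IsGrading [DecidableEq L] (B : Subalgebra k A) (𝒜 : L → Submodule k A) : Prop where
  isInternal : DirectSum.IsInternal 𝒜
  mul_le : ∀ s t, 𝒜 s * 𝒜 t ≤ 𝒜 (s * t)
  neutral : 𝒜 1 = Subalgebra.toSubmodule B

namespace IsGrading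

variable [DecidableEq L]

theorem mem_neutral (h : IsGrading B 𝒜) {x : A} : x ∈ 𝒜 1 ↔ x ∈ B := by
  rw [h.neutral, Subalgebra.mem_toSubmodule]

theorem mul_mem (h : IsGrading B 𝒜) {s t : L} {x y : A} (hx : x ∈ 𝒜 s) (hy : y ∈ 𝒜 t) :
    x * y ∈ 𝒜 (s * t) :=
  h.mul_le s t (Submodule.mul_mem_mul hx hy)

theorem mul_mem_iSup_ne (h : IsGrading B 𝒜) {s t : L} {x y : A} (hx : x ∈ 𝒜 s)
    (hy : y ∈ ⨆ r ≠ t, 𝒜 r) : x * y ∈ ⨆ r ≠ s * t, 𝒜 r := by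
  suffices ⨆ r ≠ t, 𝒜 r ≤ (⨆ r ≠ s * t, 𝒜 r).comap (LinearMap.mulLeft k x) from this hy
  refine iSup₂_le fun r hr z hz => ?_
  exact Submodule.mem_iSup_of_mem (s * r) <|
    Submodule.mem_iSup_of_mem (mul_right_injective s |>.ne hr) (h.mul_mem hx hz)

theorem mem_of_mul_mem (h : IsGrading B 𝒜) {s t : L} {u : Aˣ} (hu : (u : A) ∈ 𝒜 s) {y : A}
    (hy : u * y ∈ 𝒜 (s * t)) : y ∈ 𝒜 t := by
  have sup_eq_top : 𝒜 t ⊔ ⨆ r ≠ t, 𝒜 r = ⊤ := by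
    rw [← iSup_split_single, h.isInternal.submodule_iSup_eq_top]
  obtain ⟨y₁, hy₁, y₂, hy₂, rfl⟩ := Submodule.mem_sup.1 (sup_eq_top.ge (Submodule.mem_top (x := y)))
  have huy₂ : u * y₂ = 0 := by
    refine Submodule.disjoint_def.1 (h.isInternal.submodule_iSupIndep (s * t)) _ ?_
      (h.mul_mem_iSup_ne hu hy₂)
    simpa [mul_add] using sub_mem hy (h.mul_mem hu hy₁)
  rw [Units.mul_right_eq_zero] at huy₂
  rwa [huy₂, add_zero]

theorem inv_mem (h : IsGrading B 𝒜) {s : L} {u : Aˣ} (hu : (u : A) ∈ 𝒜 s) :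
    (↑u⁻¹ : A) ∈ 𝒜 s⁻¹ := by
  refine h.mem_of_mul_mem hu ?_
  rw [Units.mul_inv, mul_inv_cancel, h.mem_neutral]
  exact one_mem B

theorem conj_mem (h : IsGrading B 𝒜) {s : L} {u : Aˣ} (hu : (u : A) ∈ 𝒜 s) {b : A} (hb : b ∈ B) :
    u * b * ↑u⁻¹ ∈ B := by
  have := h.mul_mem (h.mul_mem hu (h.mem_neutral.2 hb)) (h.inv_mem hu)
  rwa [mul_one, mul_inv_cancel, h.mem_neutral] at this

/-- Conjugation by a homogeneous unit, as an endomorphism of the neutral component. -/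
def conj (h : IsGrading B 𝒜) {s : L} (u : Aˣ) (hu : (u : A) ∈ 𝒜 s) : B →ₐ[k] B :=
  ((MulSemiringAction.toAlgHom k A (ConjAct.toConjAct u)).comp B.val).codRestrict B
    fun b => h.conj_mem hu b.2

@[simp]
theorem coe_conj (h : IsGrading B 𝒜) {s : L} (u : Aˣ) (hu : (u : A) ∈ 𝒜 s) (b : B) :
    (h.conj u hu b : A) = u * b * ↑u⁻¹ :=
  rfl

theorem cocycle_mem (h : IsGrading B 𝒜) {s t : L} {u v w : Aˣ} (hu : (u : A) ∈ 𝒜 s)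
    (hv : (v : A) ∈ 𝒜 t) (hw : (w : A) ∈ 𝒜 (s * t)) : (↑(u * v * w⁻¹) : A) ∈ B := by
  have := h.mul_mem (h.mul_mem hu hv) (h.inv_mem hw)
  rwa [mul_inv_cancel, h.mem_neutral] at this

/-- The unit of the neutral component given by a homogeneous unit of neutral degree. -/
def neutralUnit (h : IsGrading B 𝒜) (u : Aˣ) (hu : (u : A) ∈ B) : Bˣ where
  val := ⟨u, hu⟩
  inv := ⟨↑u⁻¹, by simpa [h.mem_neutral] using h.inv_mem (h.mem_neutral.2 hu)⟩
  val_inv := Subtype.ext u.mul_inv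
  inv_val := Subtype.ext u.inv_mul

/-- Right multiplication by a homogeneous unit of degree `s`, as an isomorphism from the neutral
component to the component of degree `s`. -/
def componentEquiv (h : IsGrading B 𝒜) {s : L} (u : Aˣ) (hu : (u : A) ∈ 𝒜 s) : B ≃ₗ[k] 𝒜 s where
  toFun b := ⟨b * u, by simpa using h.mul_mem (h.mem_neutral.2 b.2) hu⟩
  invFun x := ⟨x * ↑u⁻¹, by simpa [h.mem_neutral] using h.mul_mem x.2 (h.inv_mem hu)⟩
  map_add' b c := by ext; simp [add_mul]
  map_smul' r b := by ext; simp
  left_inv b := by ext; simp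
  right_inv x := by ext; simp

open scoped Classical in
/-- The isomorphism `(b_s)_s ↦ ∑ b_s u_s` given by homogeneous units `u s` of degree `s`. -/
def finsuppEquiv (h : IsGrading B 𝒜) (u : L → Aˣ) (hu : ∀ s, (u s : A) ∈ 𝒜 s) :
    (L →₀ B) ≃ₗ[k] A :=
  finsuppLequivDFinsupp k ≪≫ₗ
    DFinsupp.mapRange.linearEquiv (fun s => h.componentEquiv (u s) (hu s)) ≪≫ₗ
    LinearEquiv.ofBijective (DirectSum.coeLinearMap 𝒜) h.isInternal

theorem finsuppEquiv_single (h : IsGrading B 𝒜) (u : L → Aˣ) (hu : ∀ s, (u s : A) ∈ 𝒜 s) (s : L)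
    (b : B) : h.finsuppEquiv u hu (Finsupp.single s b) = b * u s := by
  classical
  simp only [finsuppEquiv, LinearEquiv.trans_apply, finsuppLequivDFinsupp_apply_apply,
    Finsupp.toDFinsupp_single, DFinsupp.mapRange.linearEquiv_apply, DFinsupp.mapRange_single]
  exact DirectSum.coeLinearMap_of _ s _

end IsGrading

end Grading

section CrossedProduct

variable {k A L : Type*} [Field k] [Ring A] [Algebra k A] [Group L] {B : Subalgebra k A}
  {𝒜 : L → Submodule k A}

/-- The crossed system attached to homogeneous units `u s` of degree `s`: the weak action is
conjugation by `u s`, and the cocycle is `σ(s, t) = u s * u t * (u (s * t))⁻¹`. -/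
def IsGrading.crossedSystem [DecidableEq L] (h : IsGrading B 𝒜) (u : L → Aˣ)
    (hu : ∀ s, (u s : A) ∈ 𝒜 s) (hu1 : u 1 = 1) : CrossedSystem k B L where
  act s := h.conj (u s) (hu s)
  cocycle s t := h.neutralUnit (u s * u t * (u (s * t))⁻¹) (h.cocycle_mem (hu s) (hu t) (hu _))
  act_one := by ext; simp [hu1]
  cocycle_one_left s := by ext; simp [neutralUnit, hu1]
  cocycle_one_right s := by ext; simp [neutralUnit, hu1]
  act_act s t b := by ext; simp [neutralUnit, mul_assoc]
  cocycle_mul r s t := by ext; simp [neutralUnit, mul_assoc]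

theorem CrossedSystem.mul_single_single {B : Type*} [Ring B] [Algebra k B]
    (S : CrossedSystem k B L) (s t : L) (a b : B) :
    S.mul (Finsupp.single s a) (Finsupp.single t b) =
      Finsupp.single (s * t) (a * S.act s b * S.cocycle s t) := by
  rw [CrossedSystem.mul, Finsupp.sum_single_index (by simp), Finsupp.sum_single_index (by simp)]

theorem CrossedSystem.map_mul_of_single {B : Type*} [Ring B] [Algebra k B]
    (S : CrossedSystem k B L) (e : (L →₀ B) →ₗ[k] A)
    (he : ∀ s t a b, e (Finsupp.single (s * t) (a * S.act s b * S.cocycle s t)) =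
      e (Finsupp.single s a) * e (Finsupp.single t b)) (v w : L →₀ B) :
    e (S.mul v w) = e v * e w := by
  have e_eq_sum (v : L →₀ B) : e v = v.sum fun s a => e (Finsupp.single s a) := by
    conv_lhs => rw [← Finsupp.sum_single v, map_finsuppSum]
  rw [e_eq_sum v, e_eq_sum w, CrossedSystem.mul]
  simp only [Finsupp.sum, map_sum, Finset.sum_mul_sum, he]

theorem IsGrading.isCrossedProduct [DecidableEq L] (h : IsGrading B 𝒜)
    (hunit : ∀ s, ∃ u : Aˣ, (u : A) ∈ 𝒜 s) : IsCrossedProduct B 𝒜 := by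
  choose v hv using hunit
  let u : L → Aˣ := Function.update v 1 1
  have hu1 : u 1 = 1 := Function.update_self ..
  have hu (s : L) : (u s : A) ∈ 𝒜 s := by
    rcases eq_or_ne s 1 with rfl | hs
    · rw [hu1, h.mem_neutral]
      exact one_mem B
    · simpa only [u, Function.update_of_ne hs] using hv s
  refine ⟨h.crossedSystem u hu hu1, h.finsuppEquiv u hu, fun b => ?_, fun s b => ?_,
    CrossedSystem.map_mul_of_single _ (h.finsuppEquiv u hu).toLinearMap fun s t a b => ?_⟩
  · rw [finsuppEquiv_single, hu1, Units.val_one, mul_one]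
  · rw [finsuppEquiv_single]
    exact (h.componentEquiv (u s) (hu s) b).2
  · simp only [LinearEquiv.coe_coe, finsuppEquiv_single]
    simp [crossedSystem, neutralUnit, mul_assoc]

theorem eq_single_of_map_mem {R M N ι : Type*} [Ring R] [AddCommGroup M] [Module R M]
    [AddCommGroup N] [Module R N] {𝒩 : ι → Submodule R N} (h𝒩 : iSupIndep 𝒩)
    {e : (ι →₀ M) →ₗ[R] N} (he : Function.Injective e)
    (hmem : ∀ i m, e (Finsupp.single i m) ∈ 𝒩 i) {v : ι →₀ M} {i : ι} (hv : e v ∈ 𝒩 i) :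
    v = Finsupp.single i (v i) := by
  classical
  have map_erase_mem : e (v.erase i) ∈ ⨆ j ≠ i, 𝒩 j := by
    rw [← Finsupp.sum_single (v.erase i), map_finsuppSum]
    refine sum_mem fun j hj => Submodule.mem_iSup_of_mem j <|
      Submodule.mem_iSup_of_mem ?_ (hmem j _)
    rw [Finsupp.support_erase] at hj
    exact Finset.ne_of_mem_erase hj
  have map_erase_mem' : e (v.erase i) ∈ 𝒩 i := by
    rw [Finsupp.erase_eq_sub_single, map_sub]
    exact sub_mem hv (hmem i _)
  have herase : v.erase i = 0 :=
    (map_eq_zero_iff e he).1 (Submodule.disjoint_def.1 (h𝒩 i) _ map_erase_mem' map_erase_mem)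
  rw [← Finsupp.single_add_erase i v, herase]
  simp

theorem IsCrossedProduct.isStronglyGraded [DecidableEq L] (h : IsCrossedProduct B 𝒜)
    (h𝒜 : DirectSum.IsInternal 𝒜) : IsStronglyGraded 𝒜 := by
  obtain ⟨S, e, -, hmem, hmul⟩ := h
  have exists_single {r : L} {x : A} (hx : x ∈ 𝒜 r) : ∃ b, e (Finsupp.single r b) = x := by
    refine ⟨e.symm x r, ?_⟩
    rw [← eq_single_of_map_mem h𝒜.submodule_iSupIndep (e := e.toLinearMap) e.injective hmem
      (by simpa using hx), e.apply_symm_apply]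
  have mul_single (s t : L) (a b : B) : e (Finsupp.single s a) * e (Finsupp.single t b) =
      e (Finsupp.single (s * t) (a * S.act s b * S.cocycle s t)) := by
    rw [← hmul, S.mul_single_single]
  refine ⟨h𝒜, fun s t => le_antisymm (Submodule.mul_le.2 fun x hx y hy => ?_) fun x hx => ?_⟩
  · obtain ⟨a, rfl⟩ := exists_single hx
    obtain ⟨b, rfl⟩ := exists_single hy
    rw [mul_single]
    exact hmem _ _
  · obtain ⟨b, rfl⟩ := exists_single hx
    have hb : e (Finsupp.single s (b * ↑(S.cocycle s t)⁻¹)) * e (Finsupp.single t 1) =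
        e (Finsupp.single (s * t) b) := by
      rw [mul_single, map_one, mul_one, Units.inv_mul_cancel_right]
    rw [← hb]
    exact Submodule.mul_mem_mul (hmem s _) (hmem t _)

end CrossedProduct

section Eigen

variable {k A : Type*} [Field k] [Ring A] [Algebra k A] {ρ : A ≃ₐ[k] A}

theorem mem_eigen {ω : kˣ} {x : A} : x ∈ eigen ρ ω ↔ ρ x = (ω : k) • x :=
  Module.End.mem_eigenspace_iff

theorem eigen_mul_eigen_le (ω τ : kˣ) : eigen ρ ω * eigen ρ τ ≤ eigen ρ (ω * τ) := by
  refine Submodule.mul_le.2 fun x hx y hy => ?_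
  rw [mem_eigen] at *
  rw [map_mul, hx, hy, smul_mul_smul_comm, Units.val_mul]

theorem eigen_one : eigen ρ 1 = Subalgebra.toSubmodule (fixed ρ) := by
  ext x
  rw [mem_eigen, Units.val_one, one_smul]
  rfl

theorem iSup_eigen_eq_top {s : Set A} (hs : Algebra.adjoin k s = ⊤) {L : Subgroup kˣ}
    (h : ∀ x ∈ s, ∃ ω ∈ L, x ∈ eigen ρ ω) : ⨆ ω : L, eigen ρ (ω : kˣ) = ⊤ := by
  have mul_le : (⨆ ω : L, eigen ρ (ω : kˣ)) * (⨆ ω : L, eigen ρ (ω : kˣ)) ≤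
      ⨆ ω : L, eigen ρ (ω : kˣ) := by
    simp only [Submodule.iSup_mul, Submodule.mul_iSup]
    exact iSup₂_le fun ω τ => (eigen_mul_eigen_le _ _).trans
      (le_iSup (fun ω : L => eigen ρ (ω : kˣ)) (τ * ω))
  refine (Submodule.eq_top_iff').2 fun x => ?_
  induction (hs ▸ Algebra.mem_top : x ∈ Algebra.adjoin k s) using Algebra.adjoin_induction with
  | mem x hx =>
    obtain ⟨ω, hω, hx⟩ := h x hx
    exact Submodule.mem_iSup_of_mem (⟨ω, hω⟩ : L) hx
  | algebraMap r => exact Submodule.mem_iSup_of_mem (1 : L) (mem_eigen.2 (by simp))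
  | add x y _ _ hx hy => exact add_mem hx hy
  | mul x y _ _ hx hy => exact mul_le (Submodule.mul_mem_mul hx hy)

theorem isGrading_eigen {s : Set A} (hs : Algebra.adjoin k s = ⊤) {L : Subgroup kˣ}
    [DecidableEq L] (h : ∀ x ∈ s, ∃ ω ∈ L, x ∈ eigen ρ ω) :
    IsGrading (fixed ρ) fun ω : L => eigen ρ (ω : kˣ) where
  isInternal := by
    refine DirectSum.isInternal_submodule_iff_iSupIndep_and_iSup_eq_top _ |>.2
      ⟨?_, iSup_eigen_eq_top hs h⟩
    exact (Module.End.eigenspaces_iSupIndep ρ.toLinearMap).comp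
      (f := fun ω : L => ((ω : kˣ) : k)) (Units.val_injective.comp Subtype.val_injective)
  mul_le ω τ := eigen_mul_eigen_le _ _
  neutral := eigen_one

end Eigen

section Degree

open Polynomial

theorem coeff_aeval_monomial_one {R A : Type*} [CommSemiring R] [Semiring A] [Algebra R A] (x : A)
    (p : R[X]) (j : ℕ) : (aeval (monomial 1 x) p).coeff j = p.coeff j • x ^ j := by
  induction p using Polynomial.induction_on' with
  | add p q hp hq => rw [map_add, coeff_add, hp, hq, coeff_add, add_smul]
  | monomial m r =>
    rw [aeval_monomial, monomial_pow, one_mul, ← Algebra.smul_def, coeff_smul, coeff_monomial,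
      coeff_monomial]
    split_ifs with h
    · rw [h]
    · rw [smul_zero, zero_smul]

theorem isNilpotent_of_map_eq_monomial_one {R A : Type*} [CommRing R] [Ring A] [Algebra R A]
    {x : A} (hx : IsIntegral R x) (δ : A →ₐ[R] A[X]) (hδ : δ x = monomial 1 x) :
    IsNilpotent x := by
  obtain ⟨p, hp, hpx⟩ := hx
  have haeval : aeval (monomial 1 x) p = 0 := by
    rw [← hδ, aeval_algHom_apply, aeval_def, hpx, map_zero]
  refine ⟨p.natDegree, ?_⟩
  simpa [coeff_aeval_monomial_one, hp.coeff_natDegree] using congr(coeff $haeval p.natDegree)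

variable {k : Type*} [Field k] {G : Type*} [CommGroup G] {n : ℕ} (g : Fin n → G)
  (χ : Fin n → G →* kˣ)

/-- The algebra map `T(V) → 𝔅(V)[X]` with `xᵢ ↦ xᵢ X`, which records the degree. -/
def degreeT : FreeAlgebra k (Fin n) →ₐ[k] (Nichols g χ)[X] :=
  FreeAlgebra.lift k fun i => monomial 1 (toNichols g χ (FreeAlgebra.ι k i))

theorem degreeT_eq_monomial {m : ℕ} {f : FreeAlgebra k (Fin n)} (hf : f ∈ tDeg k n m) :
    degreeT g χ f = monomial m (toNichols g χ f) := by
  have degreeT_eq_monomial_one {v : FreeAlgebra k (Fin n)}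
      (hv : v ∈ Submodule.span k (Set.range (FreeAlgebra.ι k))) :
      degreeT g χ v = monomial 1 (toNichols g χ v) := by
    induction hv using Submodule.span_induction with
    | mem v hv => obtain ⟨i, rfl⟩ := hv; simp [degreeT]
    | zero => simp
    | add v w _ _ hv hw => simp [hv, hw]
    | smul c v _ hv => rw [map_smul, map_smul, hv, smul_monomial]
  induction hf using Submodule.pow_induction_on_left' with
  | algebraMap c => rw [AlgHom.commutes, AlgHom.commutes]; rfl
  | add f f' m _ _ hf hf' => rw [map_add, map_add, map_add, hf, hf']
  | mem_mul v hv m f _ hf =>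
    rw [map_mul, map_mul, hf, degreeT_eq_monomial_one hv, monomial_mul_monomial, add_comm]

theorem degreeT_eq_zero (f : FreeAlgebra k (Fin n)) (hf : f ∈ nicholsIdeal g χ) :
    degreeT g χ f = 0 := by
  have le_ker {I : Ideal (FreeAlgebra k (Fin n))} (hI : IsBraidedBiideal g χ I) :
      I.restrictScalars k ≤ LinearMap.ker (degreeT g χ).toLinearMap := by
    refine hI.homogeneous.trans (iSup_le fun m f hf => ?_)
    rw [LinearMap.mem_ker, AlgHom.toLinearMap_apply, degreeT_eq_monomial g χ hf.2,
      toNichols_eq_zero g χ (le_nicholsIdeal hI hf.1), monomial_zero_right]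
  exact nicholsIdeal_induction g χ (p := fun f => degreeT g χ f = 0) (fun I hI f hf => le_ker hI hf)
    (map_zero _) (fun f f' hf hf' => by rw [map_add, hf, hf', add_zero]) hf

theorem isNilpotent_genX [Module.Finite k (Nichols g χ)] (i : Fin n) :
    IsNilpotent (genX g χ i) := by
  refine IsNilpotent.map ?_ (ofNichols g χ)
  refine isNilpotent_of_map_eq_monomial_one (Algebra.IsIntegral.isIntegral (R := k) _)
    (Nichols.lift g χ (degreeT g χ) (degreeT_eq_zero g χ)) ?_
  rw [Nichols.lift_toNichols, degreeT, FreeAlgebra.lift_ι_apply]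

end Degree

section GroupAlgebra

/-- The endomorphism `a ↦ c(a) a` of the group algebra given by a character `c`. -/
def twist {R M : Type*} [CommSemiring R] [Monoid M] (c : M →* R) :
    MonoidAlgebra R M →ₐ[R] MonoidAlgebra R M :=
  MonoidAlgebra.lift R _ M
    { toFun := fun a => MonoidAlgebra.single a (c a)
      map_one' := by rw [map_one, MonoidAlgebra.one_def]
      map_mul' := fun a b => by rw [map_mul, MonoidAlgebra.single_mul_single] }

theorem coeff_twist {R M : Type*} [CommSemiring R] [Monoid M] (c : M →* R)
    (f : MonoidAlgebra R M) (a : M) : (twist c f).coeff a = c a * f.coeff a := by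
  classical
  induction f using MonoidAlgebra.induction_linear with
  | zero => simp
  | add f f' hf hf' => simp [hf, hf', mul_add]
  | single b r =>
    rcases eq_or_ne b a with rfl | h
    · simp [twist, mul_comm]
    · simp [twist, h]

end GroupAlgebra

section Bosonization

open Coalgebra

variable {k : Type*} [Field k] {G : Type*} [CommGroup G] {n : ℕ} {g : Fin n → G}
  {χ : Fin n → G →* kˣ}

theorem isGroupLikeElem_ofG (a : G) : IsGroupLikeElem k (ofG g χ a) where
  counit_eq_one := bosCounit_ofG g χ a
  comul_eq_tmul_self := bosComul_ofG g χ a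

theorem comul_genX (i : Fin n) :
    comul (R := k) (genX g χ i) = ofG g χ (g i) ⊗ₜ genX g χ i + genX g χ i ⊗ₜ 1 :=
  bosComul_genX g χ i

theorem ofG_mul_ofG_inv (a : G) : ofG g χ a * ofG g χ a⁻¹ = 1 := by
  rw [← map_mul, mul_inv_cancel, map_one]

instance [Finite G] [Module.Finite k (Nichols g χ)] : Module.Finite k (Bos g χ) :=
  Module.Finite.equiv (SkewMonoidAlgebra.coeffLinearEquiv (S := k)).symm

theorem Bos.adjoin_eq_top :
    Algebra.adjoin k (Set.range (ofG g χ) ∪ Set.range (genX g χ)) = ⊤ := by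
  have range_ofNichols_le : (ofNichols g χ).range ≤ Algebra.adjoin k (Set.range (genX g χ)) := by
    have hrange : ((ofNichols g χ).comp (toNichols g χ)) '' Set.range (FreeAlgebra.ι k) =
        Set.range (genX g χ) := (Set.range_comp _ _).symm
    rw [← hrange, ← AlgHom.map_adjoin, FreeAlgebra.adjoin_range_ι]
    rintro _ ⟨r, rfl⟩
    obtain ⟨f, rfl⟩ := toNichols_surjective g χ r
    exact ⟨f, Algebra.mem_top, rfl⟩
  refine Algebra.eq_top_iff.2 fun h => ?_
  induction h using SkewMonoidAlgebra.induction_on with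
  | zero => exact zero_mem _
  | add h h' hh hh' => exact add_mem hh hh'
  | single a r =>
    rw [single_eq]
    exact mul_mem
      (Algebra.adjoin_mono Set.subset_union_right (range_ofNichols_le ⟨r, rfl⟩))
      (Algebra.subset_adjoin (Or.inl ⟨a, rfl⟩))

theorem Bos.galoisMap_surjective : Function.Surjective (galoisMap k (Bos g χ)) := by
  refine galoisMap_surjective_of_adjoin_eq_top Bos.adjoin_eq_top ?_
  rintro _ (⟨a, rfl⟩ | ⟨i, rfl⟩)
  · refine ⟨ofG g χ a ⊗ₜ ofG g χ a⁻¹, ?_⟩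
    simp [(isGroupLikeElem_ofG a).comul_eq_tmul_self, ofG_mul_ofG_inv]
  · refine ⟨genX g χ i ⊗ₜ 1 - ofG g χ (g i) ⊗ₜ (ofG g χ (g i)⁻¹ * genX g χ i), ?_⟩
    simp [(isGroupLikeElem_ofG (g i)).comul_eq_tmul_self, comul_genX, ← mul_assoc,
      ofG_mul_ofG_inv, ← Algebra.TensorProduct.one_def]

instance [Finite G] [Module.Finite k (Nichols g χ)] : HopfAlgebra k (Bos g χ) :=
  hopfAlgebraOfGaloisMapSurjective Bos.galoisMap_surjective

/-- The algebra map `H → kG` that is the identity on `G` and kills the `xᵢ`. -/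
def toGroupAlgebra (g : Fin n → G) (χ : Fin n → G →* kˣ) : Bos g χ →ₐ[k] MonoidAlgebra k G :=
  Bos.lift g χ ((Algebra.ofId k _).comp
    (Nichols.lift g χ (FreeAlgebra.lift k fun _ => 0) (counitT_eq_zero g χ)))
    (MonoidAlgebra.of k G) fun a i => by simp

@[simp]
theorem toGroupAlgebra_ofG (a : G) :
    toGroupAlgebra g χ (ofG g χ a) = MonoidAlgebra.single a 1 := by
  rw [toGroupAlgebra, Bos.lift_ofG, MonoidAlgebra.of_apply]

@[simp]
theorem toGroupAlgebra_genX (i : Fin n) : toGroupAlgebra g χ (genX g χ i) = 0 := by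
  rw [toGroupAlgebra, genX, Bos.lift_ofNichols]
  simp

section Diagonal

variable {ρ : Bos g χ ≃ₐ[k] Bos g χ} {c : G →* kˣ} {q : Fin n → kˣ}

theorem toGroupAlgebra_apply_of_mem_eigen (hG : ∀ a, ofG g χ a ∈ eigen ρ (c a))
    (hx : ∀ i, genX g χ i ∈ eigen ρ (q i)) (h : Bos g χ) :
    toGroupAlgebra g χ (ρ h) = twist ((Units.coeHom k).comp c) (toGroupAlgebra g χ h) := by
  have heq : (toGroupAlgebra g χ).comp (ρ : Bos g χ →ₐ[k] Bos g χ) =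
      (twist ((Units.coeHom k).comp c)).comp (toGroupAlgebra g χ) :=
    Bos.algHom_ext (fun a => by simp [mem_eigen.1 (hG a), twist])
      fun i => by simp [mem_eigen.1 (hx i)]
  exact congr($heq h)

theorem toGroupAlgebra_eq_zero (hG : ∀ a, ofG g χ a ∈ eigen ρ (c a))
    (hx : ∀ i, genX g χ i ∈ eigen ρ (q i)) {ω : kˣ} (hω : ω ∉ c.range) {h : Bos g χ}
    (hh : h ∈ eigen ρ ω) : toGroupAlgebra g χ h = 0 := by
  ext a
  have hcoeff : (ω : k) * (toGroupAlgebra g χ h).coeff a =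
      c a * (toGroupAlgebra g χ h).coeff a := by
    have := toGroupAlgebra_apply_of_mem_eigen hG hx h
    rw [mem_eigen.1 hh, map_smul] at this
    simpa [coeff_twist] using congr(($this).coeff a)
  by_contra h0
  exact hω ⟨a, (Units.ext (mul_right_cancel₀ h0 hcoeff)).symm⟩

theorem mem_range_of_one_mem_eigen_mul_eigen (hG : ∀ a, ofG g χ a ∈ eigen ρ (c a))
    (hx : ∀ i, genX g χ i ∈ eigen ρ (q i)) {ω τ : kˣ} (h1 : 1 ∈ eigen ρ ω * eigen ρ τ) :
    ω ∈ c.range := by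
  by_contra hω
  have hle : eigen ρ ω * eigen ρ τ ≤ LinearMap.ker (toGroupAlgebra g χ).toLinearMap := by
    refine Submodule.mul_le.2 fun x hx' y _ => ?_
    rw [LinearMap.mem_ker, AlgHom.toLinearMap_apply, map_mul,
      toGroupAlgebra_eq_zero hG hx hω hx', zero_mul]
  exact one_ne_zero ((map_one (toGroupAlgebra g χ)).symm.trans (hle h1))

end Diagonal

/-- The restriction of the modular function to `G`. -/
def modularChar (α : Bos g χ →ₐ[k] k) : G →* kˣ :=
  ((α : Bos g χ →* k).comp (ofG g χ)).toHomUnits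

theorem coe_modularChar (α : Bos g χ →ₐ[k] k) (a : G) : (modularChar α a : k) = α (ofG g χ a) :=
  rfl

theorem range_inv_modularChar (α : Bos g χ →ₐ[k] k) : ((modularChar α)⁻¹).range = L₂ α := by
  ext ω
  refine ⟨?_, ?_⟩
  · rintro ⟨a, rfl⟩
    exact inv_mem (⟨a, rfl⟩ : modularChar α a ∈ L₂ α)
  · intro hω
    obtain ⟨a, ha⟩ := inv_mem hω
    exact ⟨a, inv_eq_iff_eq_inv.2 ha⟩

theorem L₂_le_L₁ (α : Bos g χ →ₐ[k] k) : L₂ α ≤ L₁ α :=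
  fun _ hω => Subgroup.subset_closure (Or.inr hω)

theorem IsStronglyGraded.L₁_eq_L₂ {α : Bos g χ →ₐ[k] k} [DecidableEq (L₁ α)]
    {ρ : Bos g χ ≃ₐ[k] Bos g χ} {q : Fin n → kˣ}
    (h : IsStronglyGraded fun ω : L₁ α => eigen ρ (ω : kˣ))
    (hG : ∀ a, ofG g χ a ∈ eigen ρ ((modularChar α)⁻¹ a))
    (hx : ∀ i, genX g χ i ∈ eigen ρ (q i)) : L₁ α = L₂ α := by
  refine le_antisymm (fun ω hω => ?_) (L₂_le_L₁ α)
  have h1 : (1 : Bos g χ) ∈ eigen ρ ω * eigen ρ ω⁻¹ := by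
    refine (h.2 ⟨ω, hω⟩ ⟨ω, hω⟩⁻¹).ge ?_
    simp [mem_eigen]
  rw [← range_inv_modularChar]
  exact mem_range_of_one_mem_eigen_mul_eigen hG hx h1

section Nakayama

variable [Finite G] [Module.Finite k (Nichols g χ)] {φ : Module.Dual k (Bos g χ)}
  {ρ : Bos g χ ≃ₐ[k] Bos g χ} {t : Bos g χ} {α : Bos g χ →ₐ[k] k}

theorem ofG_mem_eigen (hφ : IsDualRightIntegral φ) (hφ0 : φ ≠ 0) (hρ : IsNakayama φ ρ)
    (ht : IsRightIntegral (k := k) t) (ht0 : t ≠ 0) (hα : IsModularFunction t α) (a : G) :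
    ofG g χ a ∈ eigen ρ ((modularChar α)⁻¹ a) := by
  have ha := hφ.nakayama_of_isGroupLikeElem hφ0 hρ (isGroupLikeElem_ofG a)
  have hcounit : counit (R := k) (ρ (ofG g χ a)) = ((modularChar α a)⁻¹ : kˣ) := by
    have h := hα.apply_nakayama ht ht0 hφ hφ0 hρ (ofG g χ a)
    rw [ha, map_smul, smul_eq_mul, (isGroupLikeElem_ofG a).counit_eq_one, ← coe_modularChar] at h
    exact Units.mul_eq_one_iff_eq_inv.1 h
  rw [mem_eigen, MonoidHom.inv_apply, ← hcounit, ← ha]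

theorem genX_mem_eigen (hφ : IsDualRightIntegral φ) (hφ0 : φ ≠ 0) (hρ : IsNakayama φ ρ)
    (ht : IsRightIntegral (k := k) t) (ht0 : t ≠ 0) (hα : IsModularFunction t α) (i : Fin n) :
    genX g χ i ∈ eigen ρ ((modularChar α)⁻¹ (g i) * (χ i (g i))⁻¹) := by
  have hg := isGroupLikeElem_ofG (k := k) (g := g) (χ := χ) (g i)
  have counit_ofG : counit (R := k) (ρ (ofG g χ (g i))) = ((modularChar α)⁻¹ (g i) : kˣ) := by
    rw [mem_eigen.1 (ofG_mem_eigen hφ hφ0 hρ ht ht0 hα (g i)), map_smul, hg.counit_eq_one,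
      smul_eq_mul, mul_one]
  have counit_genX : counit (R := k) (ρ (genX g χ i)) = 0 :=
    ((isNilpotent_genX g χ i).map ((Bialgebra.counitAlgHom k (Bos g χ)).comp
      (ρ : Bos g χ →ₐ[k] Bos g χ))).eq_zero
  have conj_genX : HopfAlgebra.antipode k (ofG g χ (g i)) * genX g χ i * ofG g χ (g i) =
      ((χ i (g i))⁻¹ : kˣ) • genX g χ i := by
    rw [eq_inv_smul_iff, Units.smul_def, mul_assoc, ← mul_smul_comm, ← ofG_mul_genX, ← mul_assoc,
      hg.antipode_mul_cancel, one_mul]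
  rw [mem_eigen, hφ.nakayama_of_comul_eq hφ0 hρ hg (comul_genX i), counit_genX, zero_smul,
    add_zero, conj_genX, counit_ofG, Units.val_mul, mul_smul]
  rfl

theorem isGrading_nakayama [DecidableEq (L₁ α)] (hφ : IsDualRightIntegral φ) (hφ0 : φ ≠ 0)
    (hρ : IsNakayama φ ρ) (ht : IsRightIntegral (k := k) t) (ht0 : t ≠ 0)
    (hα : IsModularFunction t α) :
    IsGrading (fixed ρ) fun ω : L₁ α => eigen ρ (ω : kˣ) := by
  refine isGrading_eigen Bos.adjoin_eq_top ?_
  have inv_modularChar_mem (a : G) : (modularChar α)⁻¹ a ∈ L₁ α :=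
    L₂_le_L₁ α (range_inv_modularChar α ▸ ⟨a, rfl⟩)
  rintro _ (⟨a, rfl⟩ | ⟨i, rfl⟩)
  · exact ⟨_, inv_modularChar_mem a, ofG_mem_eigen hφ hφ0 hρ ht ht0 hα a⟩
  · exact ⟨_, mul_mem (inv_modularChar_mem _) (inv_mem (Subgroup.subset_closure (Or.inl ⟨i, rfl⟩))),
      genX_mem_eigen hφ hφ0 hρ ht ht0 hα i⟩

end Nakayama

end Bosonization

end NicholsDiag

end

open NicholsDiag in
theorem mainTheorem2 {k : Type*} [Field k] {G : Type*} [CommGroup G] [Finite G] {n : ℕ}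
    (g : Fin n → G) (χ : Fin n → G →* kˣ) [Module.Finite k (Nichols g χ)]
    (φ : Module.Dual k (Bos g χ)) (hφ : IsDualRightIntegral φ) (hφ0 : φ ≠ 0)
    (ρ : Bos g χ ≃ₐ[k] Bos g χ) (hρ : IsNakayama φ ρ)
    (t : Bos g χ) (ht : IsRightIntegral (k := k) t) (ht0 : t ≠ 0)
    (α : Bos g χ →ₐ[k] k) (hα : IsModularFunction t α) :
    letI := Classical.decEq (L₁ α)
    DirectSum.IsInternal (fun ω : L₁ α => eigen ρ (ω : kˣ)) ∧
    List.TFAE [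
      IsStronglyGraded (fun ω : L₁ α => eigen ρ (ω : kˣ)),
      L₁ α = L₂ α,
      ∀ ω : L₁ α, ∃ a : G, ofG g χ a ∈ eigen ρ (ω : kˣ),
      IsCrossedProduct (fixed ρ) (fun ω : L₁ α => eigen ρ (ω : kˣ))] := by
  let := Classical.decEq (L₁ α)
  have hG := ofG_mem_eigen hφ hφ0 hρ ht ht0 hα
  have hgrading := isGrading_nakayama hφ hφ0 hρ ht ht0 hα
  refine ⟨hgrading.isInternal, ?_⟩
  tfae_have 1 → 2 := fun h => h.L₁_eq_L₂ hG (genX_mem_eigen hφ hφ0 hρ ht ht0 hα)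
  tfae_have 2 → 3 := by
    intro h ω
    obtain ⟨a, ha⟩ : (ω : kˣ) ∈ ((modularChar α)⁻¹).range := by
      rw [range_inv_modularChar, ← h]
      exact ω.2
    exact ⟨a, ha ▸ hG a⟩
  tfae_have 3 → 4 := fun h => hgrading.isCrossedProduct fun ω =>
    (h ω).imp' (fun a => (ofG g χ).toHomUnits a) fun a ha => ha
  tfae_have 4 → 1 := fun h => h.isStronglyGraded hgrading.isInternal
  tfae_finish
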